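/- Let $k$ be a commutative artinian ring and let $\Lambda$ be a $k$-algebra that is finitely generated as a $k$-module (an Artinian algebra). All modules are finitely generated; $\Lambda$-modules are left modules unless stated otherwise. For a $\Lambda$-module $M$ with a presentation $P_1\xrightarrow{f} P_0\to M\to 0$ by finitely generated projective modules, the Auslander transpose is the right $\Lambda$-module $\operatorname{Tr}M=\operatorname{Coker}\big(\operatorname{Hom}_\Lambda(P_0,\Lambda)\xrightarrow{f^*}\operatorname{Hom}_\Lambda(P_1,\Lambda)\big)$; it is independent of the presentation up to projective direct summands. The module $M$ is called Gorenstein projective if $\operatorname{Ext}^i_\Lambda(M,\Lambda)=0$ and $\operatorname{Ext}^i_{\Lambda^{\mathrm{op}}}(\operatorname{Tr}M,\Lambda)=0$ for all $i\ge 1$. The algebra $\Lambda$ is called CM-finite if there are only finitely many isomorphism classes of indecomposable Gorenstein projective $\Lambda$-modules. Theorem. If $\Lambda$ is CM-finite, then $\Lambda$ satisfies the Gorenstein projective conjecture: a Gorenstein projective $\Lambda$-module $M$ is projective if and only if $\operatorname{Ext}^i_\Lambda(M,M)=0$ for all $i\ge 1$. -/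

import Mathlib

open CategoryTheory CategoryTheory.Abelian

universe u

namespace GorensteinProjective

section

variable (Λ : Type u) [Ring Λ]

/-- `Ext^i_Λ(M, N) = 0` for all `i ≥ 1`. -/
def ExtVanishing (M N : ModuleCat.{u} Λ) : Prop :=
  ∀ i : ℕ, 1 ≤ i → Subsingleton (Ext M N i)

/-- A projective presentation `P₁ → P₀ → M → 0` of a left `Λ`-module `M` by finitely generated
projective left `Λ`-modules. -/
structure Presentation (M : ModuleCat.{u} Λ) where
  P₁ : ModuleCat.{u} Λ
  P₀ : ModuleCat.{u} Λ
  f : P₁ →ₗ[Λ] P₀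
  g : P₀ →ₗ[Λ] M
  finite₁ : Module.Finite Λ P₁
  finite₀ : Module.Finite Λ P₀
  projective₁ : Module.Projective Λ P₁
  projective₀ : Module.Projective Λ P₀
  exact : Function.Exact f g
  surjective : Function.Surjective g

variable {Λ}

/-- The right `Λ`-linear map `f^* : Hom_Λ(Q, Λ) → Hom_Λ(P, Λ)`, `φ ↦ φ ∘ f`.
Right `Λ`-modules are modules over `Λᵐᵒᵖ`; on `Hom_Λ(P, Λ)` the action is
`(φ · a)(x) = φ(x) a`. -/
def dualMap {P Q : ModuleCat.{u} Λ} (f : P →ₗ[Λ] Q) :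
    (Q →ₗ[Λ] Λ) →ₗ[Λᵐᵒᵖ] (P →ₗ[Λ] Λ) where
  toFun φ := φ.comp f
  map_add' φ ψ := LinearMap.add_comp f ψ φ
  map_smul' a φ := LinearMap.smul_comp a φ f

/-- The Auslander transpose `Tr M = Coker(P₀^* → P₁^*)`, a right `Λ`-module, computed from the
given projective presentation `P₁ → P₀ → M → 0`. Up to projective direct summands it depends
only on `M`. -/
def Presentation.transpose {M : ModuleCat.{u} Λ} (p : Presentation Λ M) : ModuleCat.{u} Λᵐᵒᵖ :=
  ModuleCat.of Λᵐᵒᵖ ((p.P₁ →ₗ[Λ] Λ) ⧸ LinearMap.range (dualMap p.f))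

/-- A finitely generated module `M` is Gorenstein projective if `Ext^i(M, Λ) = 0` and
`Ext^i(Tr M, Λ) = 0` for all `i ≥ 1`. Since `Tr M` is unique up to projective direct summands,
the second condition does not depend on the presentation that computes `Tr M`; it is stated
for all of them. -/
structure IsGorensteinProjective (M : ModuleCat.{u} Λ) : Prop where
  finite : Module.Finite Λ M
  ext_self : ExtVanishing Λ M (ModuleCat.of Λ Λ)
  ext_transpose : ∀ p : Presentation Λ M,
    ExtVanishing Λᵐᵒᵖ p.transpose (ModuleCat.of Λᵐᵒᵖ Λ)

variable (Λ)

/-- `Λ` is CM-finite: up to isomorphism there are only finitely many indecomposable (finitely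
generated) Gorenstein projective left `Λ`-modules. -/
def IsCMFinite : Prop :=
  ∃ (n : ℕ) (X : Fin n → ModuleCat.{u} Λ), ∀ M : ModuleCat.{u} Λ,
    IsGorensteinProjective M → Indecomposable M → ∃ i, Nonempty (M ≅ X i)

/-- `Λ` satisfies the Gorenstein projective conjecture: a (finitely generated) Gorenstein
projective left `Λ`-module `M` is projective if and only if `Ext^i(M, M) = 0` for all `i ≥ 1`. -/
def SatisfiesGPC : Prop :=
  ∀ M : ModuleCat.{u} Λ, IsGorensteinProjective M →
    (Module.Projective Λ M ↔ ExtVanishing Λ M M)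

/-- Presentations exist for finitely generated modules over a left noetherian ring. -/
theorem nonempty_presentation [IsNoetherianRing Λ] (M : ModuleCat.{u} Λ) [Module.Finite Λ M] :
    Nonempty (Presentation Λ M) := by
  obtain ⟨n, g, hg⟩ := Module.Finite.exists_fin' Λ M
  obtain ⟨m, h, hh⟩ := Module.Finite.exists_fin' Λ (LinearMap.ker g)
  refine ⟨⟨ModuleCat.of Λ (Fin m → Λ), ModuleCat.of Λ (Fin n → Λ),
    (LinearMap.ker g).subtype.comp h, g, inferInstanceAs (Module.Finite Λ (Fin m → Λ)),
    inferInstanceAs (Module.Finite Λ (Fin n → Λ)), inferInstanceAs (Module.Projective Λ (Fin m → Λ)),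
    inferInstanceAs (Module.Projective Λ (Fin n → Λ)), ?_, hg⟩⟩
  rw [LinearMap.exact_iff]
  change LinearMap.ker g = LinearMap.range ((LinearMap.ker g).subtype.comp h)
  rw [LinearMap.range_comp, LinearMap.range_eq_top.2 hh, Submodule.map_top, Submodule.range_subtype]

end

end GorensteinProjective

namespace GorensteinProjective

/-! ### Ext vanishing: retracts, finite sums, dimension shifting. -/

section Ext

variable {R : Type u} [Ring R]

/-! Syzygies of a self-orthogonal Gorenstein projective module are again Gorenstein projective
(`IsSyzygy.isGorensteinProjective`) and self-orthogonal (`IsSyzygy.extVanishing_self`). By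
CM-finiteness, two of them, `K a` and `K b` with `a < b`, have the same indecomposable summands up
to multiplicity, so `Ext^i(K a, K b) = 0` for all `i ≥ 1`
(`IsGorensteinProjective.extVanishing_of_retracts`). Dimension shifting in the second variable turns
the vanishing in degree `b - a` into `Ext^1(K a, K (a + 1)) = 0`: the sequence defining `K (a + 1)`
splits and `K a` is projective. Since `Ext^1(-, projective)` vanishes on Gorenstein projectives,
projectivity climbs back from `K a` to `K 0 = M`. -/

lemma ExtVanishing.of_retract_left {X Y N : ModuleCat.{u} R} (r : Retract X Y)
    (h : ExtVanishing R Y N) : ExtVanishing R X N := fun n hn ↦ by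
  have := h n hn
  refine subsingleton_of_forall_eq 0 fun x ↦ ?_
  have : x = (Ext.mk₀ r.i).comp ((Ext.mk₀ r.r).comp x (zero_add n)) (zero_add n) := by
    simp
  rw [this, Subsingleton.elim ((Ext.mk₀ r.r).comp x (zero_add n)) 0, Ext.comp_zero]

lemma ExtVanishing.of_retract_right {X Y N : ModuleCat.{u} R} (r : Retract X Y)
    (h : ExtVanishing R N Y) : ExtVanishing R N X := fun n hn ↦ by
  have := h n hn
  refine subsingleton_of_forall_eq 0 fun x ↦ ?_
  have : x = (x.comp (Ext.mk₀ r.i) (add_zero n)).comp (Ext.mk₀ r.r) (add_zero n) := by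
    simp
  rw [this, Subsingleton.elim (x.comp (Ext.mk₀ r.i) (add_zero n)) 0, Ext.zero_comp]

lemma ExtVanishing.of_isZero_right {N X : ModuleCat.{u} R} (hX : Limits.IsZero X) :
    ExtVanishing R N X := fun n _ ↦
  subsingleton_of_forall_eq 0 fun x ↦ by
    rw [← Ext.comp_mk₀_id x, hX.eq_of_src (𝟙 X) 0, Ext.mk₀_zero, Ext.comp_zero]

lemma ExtVanishing.biprod_right {N X Y : ModuleCat.{u} R} (hX : ExtVanishing R N X)
    (hY : ExtVanishing R N Y) : ExtVanishing R N (X ⊞ Y) := fun n hn ↦ by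
  have := hX n hn
  have := hY n hn
  refine subsingleton_of_forall_eq 0 fun x ↦ ?_
  rw [← Ext.comp_mk₀_id x, ← Limits.biprod.total, Ext.mk₀_add, Ext.comp_add,
    ← Ext.mk₀_comp_mk₀, ← Ext.mk₀_comp_mk₀, ← Ext.comp_assoc_of_third_deg_zero,
    ← Ext.comp_assoc_of_third_deg_zero,
    Subsingleton.elim (x.comp (Ext.mk₀ Limits.biprod.fst) (add_zero n)) 0,
    Subsingleton.elim (x.comp (Ext.mk₀ Limits.biprod.snd) (add_zero n)) 0]
  simp

/-- A retraction between modules, from linear maps. -/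
def retractOfLinear {X Y : ModuleCat.{u} R} (i : X →ₗ[R] Y) (r : Y →ₗ[R] X)
    (h : r ∘ₗ i = LinearMap.id) : Retract X Y where
  i := ModuleCat.ofHom i
  r := ModuleCat.ofHom r
  retract := by
    ext x
    exact LinearMap.congr_fun h x

lemma ExtVanishing.pi {N X : ModuleCat.{u} R} (h : ExtVanishing R N X) (n : ℕ) :
    ExtVanishing R N (ModuleCat.of R (Fin n → X)) := by
  induction n with
  | zero =>
    exact .of_isZero_right (ModuleCat.isZero_of_subsingleton _)
  | succ n ih =>
    let S : ModuleCat.{u} R := ModuleCat.of R (Fin n → X)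
    let inl : (ModuleCat.of R (Fin (n + 1) → X)) ⟶ X := ModuleCat.ofHom (LinearMap.proj 0)
    let inr : (ModuleCat.of R (Fin (n + 1) → X)) ⟶ S :=
      ModuleCat.ofHom (LinearMap.pi fun i ↦ LinearMap.proj i.succ)
    let jnl : X ⟶ ModuleCat.of R (Fin (n + 1) → X) :=
      ModuleCat.ofHom (LinearMap.single R (fun _ ↦ X) 0)
    let jnr : S ⟶ ModuleCat.of R (Fin (n + 1) → X) :=
      ModuleCat.ofHom (LinearMap.pi (Fin.cases 0 fun i ↦ LinearMap.proj i))
    refine (h.biprod_right ih).of_retract_right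
      ⟨Limits.biprod.lift inl inr, Limits.biprod.desc jnl jnr, ?_⟩
    rw [Limits.biprod.lift_desc]
    refine ModuleCat.hom_ext (LinearMap.ext fun v ↦ funext fun j ↦ ?_)
    refine Fin.cases ?_ (fun j ↦ ?_) j <;> simp [inl, inr, jnl, jnr, S]

lemma ExtVanishing.of_projective_right {N P : ModuleCat.{u} R} [Module.Finite R P]
    [Module.Projective R P] (h : ExtVanishing R N (ModuleCat.of R R)) : ExtVanishing R N P := by
  obtain ⟨n, f, g, -, -, hfg⟩ := Module.Finite.exists_comp_eq_id_of_projective R P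
  exact (h.pi n).of_retract_right (retractOfLinear (Y := ModuleCat.of R (Fin n → R)) g f hfg)

lemma ExtVanishing.of_projective_left {P N : ModuleCat.{u} R} [Module.Projective R P] :
    ExtVanishing R P N := by
  have : Projective P := ModuleCat.projective_of_categoryTheory_projective P
  rintro (_ | n) hn
  · omega
  · exact Ext.subsingleton_of_projective P N n

/-- The short complex given by an exact pair of linear maps. -/
abbrev shortComplexOfLinear {K P M : ModuleCat.{u} R} {i : K →ₗ[R] P} {π : P →ₗ[R] M}
    (h : Function.Exact i π) : ShortComplex (ModuleCat.{u} R) :=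
  ShortComplex.mk (ModuleCat.ofHom i) (ModuleCat.ofHom π)
    (by ext x; exact h.apply_apply_eq_zero x)

lemma shortExact_of_linear {K P M : ModuleCat.{u} R} {i : K →ₗ[R] P} {π : P →ₗ[R] M}
    (h : Function.Exact i π) (hi : Function.Injective i) (hπ : Function.Surjective π) :
    (shortComplexOfLinear h).ShortExact where
  exact := (ShortComplex.ShortExact.moduleCat_exact_iff_function_exact _).2 h
  mono_f := (ModuleCat.mono_iff_injective _).2 hi
  epi_g := (ModuleCat.epi_iff_surjective _).2 hπ

lemma exists_extension {S : ShortComplex (ModuleCat.{u} R)} (hS : S.ShortExact)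
    {Y : ModuleCat.{u} R} (h : Subsingleton (Ext S.X₃ Y 1)) (f : S.X₁ ⟶ Y) :
    ∃ g : S.X₂ ⟶ Y, S.f ≫ g = f := by
  obtain ⟨x, hx⟩ := Ext.contravariant_sequence_exact₁ hS Y (Ext.mk₀ f) (add_zero 1)
    (Subsingleton.elim _ _)
  obtain ⟨g, rfl⟩ := (Ext.mk₀_bijective S.X₂ Y).2 x
  exact ⟨g, (Ext.mk₀_bijective S.X₁ Y).1 (by rw [← hx, Ext.mk₀_comp_mk₀])⟩

lemma subsingleton_ext_one_of_extension {S : ShortComplex (ModuleCat.{u} R)} (hS : S.ShortExact)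
    {Y : ModuleCat.{u} R} (h₂ : Subsingleton (Ext S.X₂ Y 1))
    (h : ∀ f : S.X₁ ⟶ Y, ∃ g : S.X₂ ⟶ Y, S.f ≫ g = f) : Subsingleton (Ext S.X₃ Y 1) := by
  refine subsingleton_of_forall_eq 0 fun x ↦ ?_
  obtain ⟨y, rfl⟩ := Ext.contravariant_sequence_exact₃ hS Y x (Subsingleton.elim _ _) (add_zero 1)
  obtain ⟨f, rfl⟩ := (Ext.mk₀_bijective S.X₁ Y).2 y
  obtain ⟨g, rfl⟩ := h f
  rw [← Ext.mk₀_comp_mk₀, hS.extClass_comp_assoc]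

lemma subsingleton_ext_succ {S : ShortComplex (ModuleCat.{u} R)} (hS : S.ShortExact)
    {Y : ModuleCat.{u} R} {n : ℕ} (h₂ : Subsingleton (Ext S.X₂ Y (n + 1)))
    (h₁ : Subsingleton (Ext S.X₁ Y n)) : Subsingleton (Ext S.X₃ Y (n + 1)) := by
  refine subsingleton_of_forall_eq 0 fun x ↦ ?_
  obtain ⟨y, rfl⟩ := Ext.contravariant_sequence_exact₃ hS Y x (Subsingleton.elim _ _) (add_comm 1 n)
  rw [Subsingleton.elim y 0, Ext.comp_zero]

lemma subsingleton_ext_of_succ {S : ShortComplex (ModuleCat.{u} R)} (hS : S.ShortExact)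
    {Y : ModuleCat.{u} R} {n : ℕ} (h₂ : Subsingleton (Ext S.X₂ Y n))
    (h₃ : Subsingleton (Ext S.X₃ Y (n + 1))) : Subsingleton (Ext S.X₁ Y n) := by
  refine subsingleton_of_forall_eq 0 fun x ↦ ?_
  obtain ⟨y, rfl⟩ := Ext.contravariant_sequence_exact₁ hS Y x (add_comm 1 n) (Subsingleton.elim _ _)
  rw [Subsingleton.elim y 0, Ext.comp_zero]

lemma subsingleton_ext_right_succ {S : ShortComplex (ModuleCat.{u} R)} (hS : S.ShortExact)
    {Y : ModuleCat.{u} R} {n : ℕ} (h₂ : Subsingleton (Ext Y S.X₂ (n + 1)))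
    (h₃ : Subsingleton (Ext Y S.X₃ n)) : Subsingleton (Ext Y S.X₁ (n + 1)) := by
  refine subsingleton_of_forall_eq 0 fun x ↦ ?_
  obtain ⟨y, rfl⟩ := Ext.covariant_sequence_exact₁ Y hS x (Subsingleton.elim _ _) rfl
  rw [Subsingleton.elim y 0, Ext.zero_comp]

lemma subsingleton_ext_right_of_succ {S : ShortComplex (ModuleCat.{u} R)} (hS : S.ShortExact)
    {Y : ModuleCat.{u} R} {n : ℕ} (h₂ : Subsingleton (Ext Y S.X₂ n))
    (h₁ : Subsingleton (Ext Y S.X₁ (n + 1))) : Subsingleton (Ext Y S.X₃ n) := by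
  refine subsingleton_of_forall_eq 0 fun x ↦ ?_
  obtain ⟨y, rfl⟩ := Ext.covariant_sequence_exact₃ Y hS x rfl (Subsingleton.elim _ _)
  rw [Subsingleton.elim y 0, Ext.zero_comp]

end Ext

/-! ### Duals of finitely generated projective modules. -/

section Dual

variable {R : Type u} [Ring R]

/-- Finitely generated projective modules have finite dual bases. -/
lemma exists_dual_basis (P : ModuleCat.{u} R) [Module.Finite R P] [Module.Projective R P] :
    ∃ (n : ℕ) (e : Fin n → P) (e' : Fin n → (P →ₗ[R] R)), ∀ x, ∑ j, e' j x • e j = x := by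
  obtain ⟨n, f, g, -, -, hfg⟩ := Module.Finite.exists_comp_eq_id_of_projective R P
  refine ⟨n, fun j ↦ f (Pi.single j 1), fun j ↦ LinearMap.proj j ∘ₗ g, fun x ↦ ?_⟩
  conv_rhs => rw [← LinearMap.id_apply (R := R) x, ← hfg, LinearMap.comp_apply,
    pi_eq_sum_univ' (g x), map_sum]
  refine Finset.sum_congr rfl fun j _ ↦ ?_
  rw [map_smul]
  congr 2

lemma dual_eq_sum {P : ModuleCat.{u} R} {n : ℕ} {e : Fin n → P} {e' : Fin n → (P →ₗ[R] R)}
    (h : ∀ x, ∑ j, e' j x • e j = x) (φ : P →ₗ[R] R) :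
    ∑ j, MulOpposite.op (φ (e j)) • e' j = φ := by
  ext x
  conv_rhs => rw [← h x, map_sum]
  simp

lemma projective_dual (P : ModuleCat.{u} R) [Module.Finite R P] [Module.Projective R P] :
    Module.Projective Rᵐᵒᵖ (P →ₗ[R] R) := by
  obtain ⟨n, e, e', h⟩ := exists_dual_basis P
  let i : (P →ₗ[R] R) →ₗ[Rᵐᵒᵖ] (Fin n → Rᵐᵒᵖ) :=
    { toFun φ j := MulOpposite.op (φ (e j))
      map_add' _ _ := rfl
      map_smul' _ _ := rfl }
  refine Module.Projective.of_split i (Fintype.linearCombination Rᵐᵒᵖ e') ?_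
  ext1 φ
  simpa [Fintype.linearCombination_apply, i] using dual_eq_sum h φ

/-- Half of the reflexivity of `P`; `eq_zero_of_dual` is the other half. -/
lemma exists_eval (P : ModuleCat.{u} R) [Module.Finite R P] [Module.Projective R P]
    (ξ : (P →ₗ[R] R) →ₗ[Rᵐᵒᵖ] R) : ∃ x : P, ∀ φ, ξ φ = φ x := by
  obtain ⟨n, e, e', h⟩ := exists_dual_basis P
  refine ⟨∑ j, ξ (e' j) • e j, fun φ ↦ ?_⟩
  conv_lhs => rw [← dual_eq_sum h φ, map_sum]
  simp

lemma eq_zero_of_dual (P : ModuleCat.{u} R) [Module.Finite R P] [Module.Projective R P] (x : P)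
    (hx : ∀ φ : P →ₗ[R] R, φ x = 0) : x = 0 := by
  obtain ⟨n, e, e', h⟩ := exists_dual_basis P
  rw [← h x]
  simp [hx]

/-- The evaluation of functionals at `x`. -/
def dualEval {P : ModuleCat.{u} R} (x : P) : (P →ₗ[R] R) →ₗ[Rᵐᵒᵖ] R where
  toFun φ := φ x
  map_add' _ _ := rfl
  map_smul' _ _ := rfl

end Dual

/-! ### Gorenstein projectives under syzygies and retracts. -/

section Closure

variable {Λ : Type u} [Ring Λ]

/-- `K` is a syzygy of `M`: the kernel of a surjection onto `M` from a finitely generated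
projective module. -/
def IsSyzygy (K M : ModuleCat.{u} Λ) : Prop :=
  ∃ (P : ModuleCat.{u} Λ) (i : K →ₗ[Λ] P) (π : P →ₗ[Λ] M), Module.Finite Λ P ∧
    Module.Projective Λ P ∧ Function.Injective i ∧ Function.Exact i π ∧ Function.Surjective π

lemma exists_isSyzygy (M : ModuleCat.{u} Λ) [Module.Finite Λ M] :
    ∃ K : ModuleCat.{u} Λ, IsSyzygy K M := by
  obtain ⟨n, g, hg⟩ := Module.Finite.exists_fin' Λ M
  exact ⟨ModuleCat.of Λ (LinearMap.ker g), ModuleCat.of Λ (Fin n → Λ), (LinearMap.ker g).subtype, g,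
    inferInstanceAs (Module.Finite Λ (Fin n → Λ)), inferInstanceAs (Module.Projective Λ (Fin n → Λ)),
    Subtype.val_injective, LinearMap.exact_subtype_ker_map g, hg⟩

/-- Splicing `p` with `P → M` presents `M`, and dualizing gives an exact sequence `0 → Tr M → P₁^* →
Tr K → 0`. Degrees at least 2 follow by dimension shifting; degree 1 needs reflexivity. -/
lemma ext_transpose_of_syzygy {K P M : ModuleCat.{u} Λ} [Module.Finite Λ P]
    [Module.Projective Λ P] {i : K →ₗ[Λ] P} {π : P →ₗ[Λ] M} (hi : Function.Injective i)
    (hiπ : Function.Exact i π) (hπ : Function.Surjective π) (hM : IsGorensteinProjective M)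
    (p : Presentation Λ K) : ExtVanishing Λᵐᵒᵖ p.transpose (ModuleCat.of Λᵐᵒᵖ Λ) := by
  have := p.finite₀
  have := p.finite₁
  have := p.projective₀
  have := p.projective₁
  have hex : Function.Exact (i ∘ₗ p.g) π := by
    rw [LinearMap.exact_iff] at hiπ ⊢
    rw [hiπ, LinearMap.range_comp, LinearMap.range_eq_top.2 p.surjective, Submodule.map_top]
  let q : Presentation Λ M := ⟨p.P₀, P, i ∘ₗ p.g, π, p.finite₀, inferInstance, p.projective₀,
    inferInstance, hex, hπ⟩
  have hgf : p.g ∘ₗ p.f = 0 := by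
    ext x
    exact p.exact.apply_apply_eq_zero x
  have hle : LinearMap.range (dualMap q.f) ≤ LinearMap.ker (dualMap p.f) := by
    rintro _ ⟨φ, rfl⟩
    change (φ ∘ₗ (i ∘ₗ p.g)) ∘ₗ p.f = 0
    rw [LinearMap.comp_assoc, LinearMap.comp_assoc, hgf, LinearMap.comp_zero, LinearMap.comp_zero]
  let D : ModuleCat.{u} Λᵐᵒᵖ := ModuleCat.of Λᵐᵒᵖ (p.P₁ →ₗ[Λ] Λ)
  let a : q.transpose →ₗ[Λᵐᵒᵖ] D := (LinearMap.range (dualMap q.f)).liftQ (dualMap p.f) hle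
  let b : D →ₗ[Λᵐᵒᵖ] p.transpose := (LinearMap.range (dualMap p.f)).mkQ
  have hab : Function.Exact a b := by
    rw [LinearMap.exact_iff]
    exact (Submodule.ker_mkQ _).trans (Submodule.range_liftQ _ _ _).symm
  have ha : Function.Injective a := by
    rw [← LinearMap.ker_eq_bot]
    -- A functional killing `p.f` descends to `K`, and extends to `P` because `Ext^1(M, Λ) = 0`.
    refine Submodule.ker_liftQ_eq_bot _ _ _ fun φ hφ ↦ ?_
    have hφ' : φ ∘ₗ p.f = 0 := hφ
    have hker : LinearMap.ker p.g ≤ LinearMap.ker φ := by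
      rw [p.exact.linearMap_ker_eq]
      rintro _ ⟨y, rfl⟩
      exact LinearMap.congr_fun hφ' y
    let ψ : K →ₗ[Λ] Λ := (LinearMap.ker p.g).liftQ φ hker ∘ₗ
      (p.g.quotKerEquivOfSurjective p.surjective).symm.toLinearMap
    have hψ : ∀ x, ψ (p.g x) = φ x := fun x ↦ by
      have : (p.g.quotKerEquivOfSurjective p.surjective).symm (p.g x) =
          (LinearMap.ker p.g).mkQ x := by
        rw [LinearEquiv.symm_apply_eq]
        rfl
      simp [ψ, this]
    obtain ⟨χ, hχ⟩ := exists_extension (shortExact_of_linear hiπ hi hπ) (hM.ext_self 1 le_rfl)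
      (ModuleCat.ofHom ψ)
    refine ⟨χ.hom, ?_⟩
    ext x
    refine Eq.trans ?_ (hψ x)
    exact congr($(hχ).hom (p.g x))
  have hS := shortExact_of_linear hab ha (Submodule.mkQ_surjective _)
  have : Module.Projective Λᵐᵒᵖ D := projective_dual p.P₁
  have hD : ExtVanishing Λᵐᵒᵖ D (ModuleCat.of Λᵐᵒᵖ Λ) := .of_projective_left
  rintro (_ | _ | n) hn
  · omega
  · refine subsingleton_ext_one_of_extension hS (hD 1 le_rfl) fun ξ ↦ ?_
    let ξ' : q.transpose →ₗ[Λᵐᵒᵖ] Λ := ξ.hom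
    -- A map `Tr M → Λ` is evaluation at some `x` with `i (p.g x) = 0`; so `x = p.f y`, and
    -- evaluation at `y` is the extension.
    obtain ⟨x, hx⟩ := exists_eval p.P₀ (ξ' ∘ₗ (LinearMap.range (dualMap q.f)).mkQ)
    have hx0 : i (p.g x) = 0 := eq_zero_of_dual P _ fun ψ ↦ by
      have h0 : (LinearMap.range (dualMap q.f)).mkQ (dualMap q.f ψ) = 0 := by
        rw [← LinearMap.mem_ker, Submodule.ker_mkQ]
        exact ⟨ψ, rfl⟩
      refine (hx (dualMap q.f ψ)).symm.trans ?_
      exact (congrArg ξ' h0).trans (map_zero ξ')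
    obtain ⟨y, rfl⟩ := (p.exact x).1 (hi (hx0.trans (map_zero i).symm))
    refine ⟨ModuleCat.ofHom (dualEval y), ?_⟩
    ext t
    obtain ⟨φ, rfl⟩ := Submodule.mkQ_surjective _ t
    exact (hx φ).symm
  · exact subsingleton_ext_succ hS (hD (n + 1 + 1) hn) (hM.ext_transpose q (n + 1) (by omega))

lemma IsSyzygy.isGorensteinProjective [IsNoetherianRing Λ] {K M : ModuleCat.{u} Λ}
    (h : IsSyzygy K M) (hM : IsGorensteinProjective M) : IsGorensteinProjective K := by
  obtain ⟨P, i, π, _, _, hi, hiπ, hπ⟩ := h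
  refine ⟨Module.Finite.of_injective i hi, fun n hn ↦ ?_, ext_transpose_of_syzygy hi hiπ hπ hM⟩
  exact subsingleton_ext_of_succ (shortExact_of_linear hiπ hi hπ)
    (ExtVanishing.of_projective_left n hn) (hM.ext_self (n + 1) (by omega))

/-- Adding a presentation of the complement `ker r` to one of `N` presents `M`, so `Tr N` is a
retract of a transpose of `M`. -/
lemma IsGorensteinProjective.of_retract [IsNoetherianRing Λ] {N M : ModuleCat.{u} Λ}
    (r : Retract N M) (hM : IsGorensteinProjective M) : IsGorensteinProjective N := by
  have := hM.finite
  have hr : ∀ x, r.r.hom (r.i.hom x) = x := fun x ↦ congr($(r.retract).hom x)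
  refine ⟨Module.Finite.of_surjective r.r.hom fun x ↦ ⟨_, hr x⟩,
    hM.ext_self.of_retract_left r, fun p ↦ ?_⟩
  obtain ⟨q⟩ := nonempty_presentation Λ (ModuleCat.of Λ (LinearMap.ker r.r.hom))
  have := p.finite₀
  have := p.finite₁
  have := p.projective₀
  have := p.projective₁
  have := q.finite₀
  have := q.finite₁
  have := q.projective₀
  have := q.projective₁
  let g : p.P₀ × q.P₀ →ₗ[Λ] M :=
    (r.i.hom ∘ₗ p.g).coprod ((LinearMap.ker r.r.hom).subtype ∘ₗ q.g)
  have hrg : ∀ x, r.r.hom (g x) = p.g x.1 := fun x ↦ by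
    have : r.r.hom (q.g x.2).1 = 0 := (q.g x.2).2
    refine (map_add r.r.hom _ _).trans ?_
    exact (congr_arg₂ (· + ·) (hr (p.g x.1)) this).trans (add_zero _)
  let s : Presentation Λ M :=
    { P₁ := ModuleCat.of Λ (p.P₁ × q.P₁)
      P₀ := ModuleCat.of Λ (p.P₀ × q.P₀)
      f := p.f.prodMap q.f
      g := g
      finite₁ := inferInstanceAs (Module.Finite Λ (p.P₁ × q.P₁))
      finite₀ := inferInstanceAs (Module.Finite Λ (p.P₀ × q.P₀))
      projective₁ := inferInstanceAs (Module.Projective Λ (p.P₁ × q.P₁))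
      projective₀ := inferInstanceAs (Module.Projective Λ (p.P₀ × q.P₀))
      exact := by
        rintro ⟨x, y⟩
        constructor
        · intro h
          have hx : p.g x = 0 := by rw [← hrg (x, y), h, map_zero]
          have hy : q.g y = 0 := by
            have : r.i.hom (p.g x) + (q.g y).1 = 0 := h
            rw [hx, map_zero, zero_add] at this
            exact Subtype.ext this
          obtain ⟨x', rfl⟩ := (p.exact x).1 hx
          obtain ⟨y', rfl⟩ := (q.exact y).1 hy
          exact ⟨(x', y'), rfl⟩
        · rintro ⟨⟨x', y'⟩, h⟩
          obtain ⟨rfl, rfl⟩ := Prod.ext_iff.1 h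
          change r.i.hom (p.g (p.f x')) + (q.g (q.f y')).1 = 0
          rw [p.exact.apply_apply_eq_zero, q.exact.apply_apply_eq_zero, map_zero, zero_add]
          rfl
      surjective := fun m ↦ by
        obtain ⟨x, hx⟩ := p.surjective (r.r.hom m)
        obtain ⟨y, hy⟩ := q.surjective ⟨m - r.i.hom (r.r.hom m), by simp [hr]⟩
        refine ⟨(x, y), ?_⟩
        change r.i.hom (p.g x) + (q.g y).1 = m
        rw [hx, hy]
        exact add_sub_cancel _ _ }
  let fst : s.P₁ →ₗ[Λ] p.P₁ := LinearMap.fst Λ p.P₁ q.P₁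
  let inl : p.P₁ →ₗ[Λ] s.P₁ := LinearMap.inl Λ p.P₁ q.P₁
  let fst₀ : s.P₀ →ₗ[Λ] p.P₀ := LinearMap.fst Λ p.P₀ q.P₀
  let inl₀ : p.P₀ →ₗ[Λ] s.P₀ := LinearMap.inl Λ p.P₀ q.P₀
  have hfst : p.f ∘ₗ fst = fst₀ ∘ₗ s.f := rfl
  have hinl : s.f ∘ₗ inl = inl₀ ∘ₗ p.f := by
    ext x
    · rfl
    · exact map_zero q.f
  have h₁ : LinearMap.range (dualMap p.f) ≤ (LinearMap.range (dualMap s.f)).comap (dualMap fst) := by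
    rintro _ ⟨φ, rfl⟩
    exact ⟨φ ∘ₗ fst₀, rfl⟩
  have h₂ : LinearMap.range (dualMap s.f) ≤ (LinearMap.range (dualMap p.f)).comap (dualMap inl) := by
    rintro _ ⟨φ, rfl⟩
    refine ⟨φ ∘ₗ inl₀, ?_⟩
    change (φ ∘ₗ inl₀) ∘ₗ p.f = (φ ∘ₗ s.f) ∘ₗ inl
    rw [LinearMap.comp_assoc, LinearMap.comp_assoc, hinl]
  refine (hM.ext_transpose s).of_retract_left (retractOfLinear
    (Submodule.mapQ _ _ (dualMap fst) h₁) (Submodule.mapQ _ _ (dualMap inl) h₂) ?_)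
  ext1 t
  obtain ⟨φ, rfl⟩ := Submodule.mkQ_surjective _ t
  rfl

end Closure

/-! ### Syzygy sequences and indecomposable summands. -/

section Syzygies

variable {Λ : Type u} [Ring Λ] {K M : ModuleCat.{u} Λ}

lemma IsSyzygy.projective_of_subsingleton_ext (h : IsSyzygy K M)
    (hMK : Subsingleton (Ext M K 1)) : Module.Projective Λ M := by
  obtain ⟨P, i, π, _, _, hi, hiπ, hπ⟩ := h
  obtain ⟨ρ, hρ⟩ := exists_extension (shortExact_of_linear hiπ hi hπ) hMK (𝟙 K)
  have hρ' : ρ.hom ∘ₗ i = LinearMap.id := congr($(hρ).hom)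
  have hsplit := (hiπ.split_tfae hi hπ).out 1 0
  obtain ⟨σ, hσ⟩ := hsplit.1 ⟨ρ.hom, hρ'⟩
  exact Module.Projective.of_split σ π hσ

lemma IsSyzygy.projective (h : IsSyzygy K M) (hM : IsGorensteinProjective M)
    [Module.Finite Λ K] [Module.Projective Λ K] : Module.Projective Λ M :=
  h.projective_of_subsingleton_ext (ExtVanishing.of_projective_right hM.ext_self 1 le_rfl)

/-- `Ext^n(M, M) = 0` gives `Ext^(n+1)(M, K) = 0`, hence `Ext^n(K, K) = 0`. -/
lemma IsSyzygy.extVanishing_self (h : IsSyzygy K M) (hM : IsGorensteinProjective M)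
    (hMM : ExtVanishing Λ M M) : ExtVanishing Λ K K := by
  obtain ⟨P, i, π, _, _, hi, hiπ, hπ⟩ := h
  have hS := shortExact_of_linear hiπ hi hπ
  exact fun n hn ↦ subsingleton_ext_of_succ hS (ExtVanishing.of_projective_left n hn)
    (subsingleton_ext_right_succ hS
      (ExtVanishing.of_projective_right hM.ext_self (n + 1) (by omega)) (hMM n hn))

lemma IsSyzygy.subsingleton_ext_of_succ (h : IsSyzygy K M) {N : ModuleCat.{u} Λ}
    (hN : IsGorensteinProjective N) {n : ℕ} (hn : 1 ≤ n)
    (hNK : Subsingleton (Ext N K (n + 1))) : Subsingleton (Ext N M n) := by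
  obtain ⟨P, i, π, _, _, hi, hiπ, hπ⟩ := h
  exact subsingleton_ext_right_of_succ (shortExact_of_linear hiπ hi hπ)
    (ExtVanishing.of_projective_right hN.ext_self n hn) hNK

lemma exists_syzygies [IsNoetherianRing Λ] (hM : IsGorensteinProjective M) :
    ∃ K : ℕ → ModuleCat.{u} Λ, K 0 = M ∧ (∀ n, IsGorensteinProjective (K n)) ∧
      ∀ n, IsSyzygy (K (n + 1)) (K n) := by
  have step : ∀ N : {N : ModuleCat.{u} Λ // IsGorensteinProjective N},
      ∃ K : {N : ModuleCat.{u} Λ // IsGorensteinProjective N}, IsSyzygy K.1 N.1 := fun N ↦ by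
    have := N.2.finite
    obtain ⟨K, hK⟩ := exists_isSyzygy N.1
    exact ⟨⟨K, hK.isGorensteinProjective N.2⟩, hK⟩
  choose s hs using step
  let K : ℕ → {N : ModuleCat.{u} Λ // IsGorensteinProjective N} :=
    fun n ↦ Nat.rec ⟨M, hM⟩ (fun _ ↦ s) n
  exact ⟨fun n ↦ (K n).1, rfl, fun n ↦ (K n).2, fun n ↦ hs (K n)⟩

/-- A Gorenstein projective module of finite length is built from the indecomposable
Gorenstein projective modules that are its direct summands. -/
lemma IsGorensteinProjective.extVanishing_of_retracts [IsNoetherianRing Λ] [IsArtinianRing Λ]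
    {ι : Type*} {X : ι → ModuleCat.{u} Λ}
    (hX : ∀ M : ModuleCat.{u} Λ, IsGorensteinProjective M → Indecomposable M →
      ∃ i, Nonempty (M ≅ X i)) {N : ModuleCat.{u} Λ} (hM : IsGorensteinProjective M)
    (h : ∀ i, Nonempty (Retract (X i) M) → ExtVanishing Λ N (X i)) : ExtVanishing Λ N M := by
  have hfin : ∀ {Y : ModuleCat.{u} Λ}, IsGorensteinProjective Y → Module.length Λ Y ≠ ⊤ :=
    fun hY ↦ by
      have := hY.finite
      exact Module.length_ne_top
  induction hl : Module.length Λ M using WellFoundedLT.induction generalizing M with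
  | ind l ih =>
  subst hl
  by_cases h0 : Limits.IsZero M
  · exact .of_isZero_right h0
  by_cases hind : Indecomposable M
  · obtain ⟨i, ⟨e⟩⟩ := hX M hM hind
    exact (h i ⟨.ofIso e.symm⟩).of_retract_right (.ofIso e)
  · simp only [Indecomposable, h0, not_false_eq_true, true_and, not_forall, not_or] at hind
    obtain ⟨Y, Z, e, hY, hZ⟩ := hind
    let rY : Retract Y M := (⟨Limits.biprod.inl, Limits.biprod.fst, by simp⟩ :
      Retract Y (Y ⊞ Z)).trans (.ofIso e.symm)
    let rZ : Retract Z M := (⟨Limits.biprod.inr, Limits.biprod.snd, by simp⟩ :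
      Retract Z (Y ⊞ Z)).trans (.ofIso e.symm)
    have gY := IsGorensteinProjective.of_retract rY hM
    have gZ := IsGorensteinProjective.of_retract rZ hM
    have hlen : Module.length Λ M = Module.length Λ Y + Module.length Λ Z := by
      rw [(e ≪≫ ModuleCat.biprodIsoProd Y Z).toLinearEquiv.length_eq]
      exact Module.length_prod ..
    have hpos : ∀ {W : ModuleCat.{u} Λ}, ¬ Limits.IsZero W → 0 < Module.length Λ W := fun hW ↦ by
      rw [Module.length_pos_iff, ← not_subsingleton_iff_nontrivial]
      exact fun _ ↦ hW (ModuleCat.isZero_of_subsingleton _)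
    refine (ExtVanishing.biprod_right (ih _ ?_ gY (fun i ⟨r⟩ ↦ h i ⟨r.trans rY⟩) rfl)
      (ih _ ?_ gZ (fun i ⟨r⟩ ↦ h i ⟨r.trans rZ⟩) rfl)).of_retract_right (.ofIso e)
    · rw [hlen]
      simpa using (ENat.add_lt_add_iff_left (hfin gY)).2 (hpos hZ)
    · rw [hlen, add_comm]
      simpa using (ENat.add_lt_add_iff_left (hfin gZ)).2 (hpos hY)

end Syzygies

/-! ### The Gorenstein projective conjecture. -/

lemma IsCMFinite.projective_of_extVanishing_self {Λ : Type u} [Ring Λ] [IsNoetherianRing Λ]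
    [IsArtinianRing Λ] (hΛ : IsCMFinite Λ) {M : ModuleCat.{u} Λ} (hM : IsGorensteinProjective M)
    (hMM : ExtVanishing Λ M M) : Module.Projective Λ M := by
  obtain ⟨m, X, hX⟩ := hΛ
  obtain ⟨K, rfl, hK, hs⟩ := exists_syzygies hM
  have hKK : ∀ n, ExtVanishing Λ (K n) (K n) := fun n ↦ by
    induction n with
    | zero => exact hMM
    | succ n ih => exact (hs n).extVanishing_self (hK n) ih
  obtain ⟨a, b, hab, hA⟩ : ∃ a b, a < b ∧ ∀ i, Nonempty (Retract (X i) (K b)) →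
      Nonempty (Retract (X i) (K a)) := by
    -- Pigeonhole: `Fin m` has only finitely many subsets.
    obtain ⟨a, b, hne, h⟩ := Finite.exists_ne_map_eq_of_infinite
      fun n ↦ {i | Nonempty (Retract (X i) (K n))}
    rcases hne.lt_or_gt with hlt | hlt
    · exact ⟨a, b, hlt, fun i ↦ (Set.ext_iff.1 h i).2⟩
    · exact ⟨b, a, hlt, fun i ↦ (Set.ext_iff.1 h i).1⟩
  have hab' : ExtVanishing Λ (K a) (K b) := (hK b).extVanishing_of_retracts hX fun i hi ↦
    (hKK a).of_retract_right (hA i hi).some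
  have shift : ∀ d, Subsingleton (Ext (K a) (K (a + d + 1)) (d + 1)) →
      Subsingleton (Ext (K a) (K (a + 1)) 1) := fun d ↦ by
    induction d with
    | zero => exact id
    | succ d ih => exact fun h ↦ ih ((hs _).subsingleton_ext_of_succ (hK a) (by omega) h)
  obtain ⟨d, rfl⟩ := Nat.exists_eq_add_of_lt hab
  have hproj : Module.Projective Λ (K a) :=
    (hs a).projective_of_subsingleton_ext (shift d (hab' (d + 1) (by omega)))
  -- Only projectivity of `K a` is needed to descend to index 0.
  clear hA hab' shift hab
  induction a with
  | zero => exact hproj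
  | succ a ih =>
    have := (hK (a + 1)).finite
    exact ih ((hs a).projective (hK a))

end GorensteinProjective

theorem theorem3p6 {k : Type*} [CommRing k] [IsArtinianRing k]
    {Λ : Type u} [Ring Λ] [Algebra k Λ] [Module.Finite k Λ]
    (hΛ : GorensteinProjective.IsCMFinite Λ) :
    GorensteinProjective.SatisfiesGPC Λ := by
  have : IsNoetherianRing Λ := isNoetherian_of_tower k inferInstance
  have : IsArtinianRing Λ := IsArtinianRing.of_finite k Λ
  exact fun M hM ↦ ⟨fun _ ↦ .of_projective_left, hΛ.projective_of_extVanishing_self hM⟩
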